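/- **Setting.** For $n\ge 0$ equip $\{-1,1\}^n$ with the uniform probability measure, with expectation $\mathbf E$ (variables $\varepsilon$ and $\delta$ are independent and uniform on $\{-1,1\}^n$). For a function $f$ on $\{-1,1\}^n$ with values in a real or complex Banach space, put $D_jf(\varepsilon)=\varepsilon_j\partial_jf(\varepsilon)$, where $\partial_jf(\varepsilon)=\tfrac12\big(f(\varepsilon)|_{\varepsilon_j=1}-f(\varepsilon)|_{\varepsilon_j=-1}\big)$, and $\Delta=D_1+\dots+D_n$. With the Walsh functions $w_A(\varepsilon)=\prod_{i\in A}\varepsilon_i$ one has $\Delta w_A=|A|w_A$; let $\Delta^{-1}f=\sum_{A\ne\emptyset}|A|^{-1}\,\mathbf E[w_Af]\,w_A$, the inverse of $\Delta$ on functions of mean zero. A Banach space $X$ has cotype $q\in[2,\infty)$ if there is a constant $T$ such that $(\sum_{i=1}^m\|x_i\|^q)^{1/q}\le T\,(\mathbf E_\delta\|\sum_{i=1}^m\delta_ix_i\|^q)^{1/q}$ for all $m$ and all $x_1,\dots,x_m\in X$. For $1<p<\infty$ and a constant $K$ consider the inequalities (F1) $\displaystyle\Big(\mathbf E_\varepsilon\Big\|\sum_{j=1}^n\Delta^{-1}D_jF_j\Big\|^p\Big)^{1/p}\le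 K\,\big(\mathbf E_{\varepsilon,\delta}\|F\|^p\big)^{1/p}$ for all $F:\{-1,1\}^n\times\{-1,1\}^n\to X$, where $F_j(\varepsilon)=\mathbf E_\delta\,\delta_jF(\varepsilon,\delta)$; (dF) $\displaystyle\Big(\mathbf E_{\varepsilon,\delta}\Big\|\sum_{j=1}^n\delta_j\Delta^{-1}D_jg(\varepsilon)\Big\|^p\Big)^{1/p}\le K\,\big(\mathbf E_\varepsilon\|g\|^p\big)^{1/p}$ for all $g:\{-1,1\}^n\to X^*$. **Theorem.** Let $1<p<\infty$ and $2\le q<\infty$. 1. There is a constant $C(p,q)>0$ such that for every Banach space $X$ of cotype $q$ and every $n$, inequality (F1) for $X$ and inequality (dF) for the dual space $X^*$ both hold with $K=C(p,q)\sqrt n$. 2. The growth in $n$ cannot be improved in this class: there are a Banach space $X$ of cotype $q$ and a constant $c>0$ such that, for every $n$, every constant $K$ for which (F1) holds for $X$, and every constant $K$ for which (dF) holds for $X^*$, satisfies $K\ge c\sqrt n$. -/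

import Mathlib

open scoped BigOperators

universe u v

noncomputable section

namespace HammingCube

/-- The Hamming cube `{-1, 1}^n`; the two units of `ℤ` are the two signs. -/
abbrev Cube (n : ℕ) : Type := Fin n → ℤˣ

/-- A sign, viewed as a scalar of `𝕜`. -/
def sgn (𝕜 : Type u) [RCLike 𝕜] (s : ℤˣ) : 𝕜 := ((s : ℤ) : 𝕜)

section Operators

variable (𝕜 : Type u) [RCLike 𝕜] {X : Type v} [NormedAddCommGroup X] [NormedSpace 𝕜 X] {n : ℕ}

/-- Expectation with respect to the uniform probability measure on the cube. -/
def mean (f : Cube n → X) : X := ((2 : 𝕜) ^ n)⁻¹ • ∑ ε : Cube n, f ε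

/-- The partial derivative `∂_j f` in the `j`-th variable (the derivative of the multi-affine
extension of `f`). -/
def partialDeriv (j : Fin n) (f : Cube n → X) (ε : Cube n) : X :=
  (2 : 𝕜)⁻¹ • (f (Function.update ε j 1) - f (Function.update ε j (-1)))

/-- `D_j = ε_j ∂_j`. -/
def D (j : Fin n) (f : Cube n → X) (ε : Cube n) : X :=
  sgn 𝕜 (ε j) • partialDeriv 𝕜 j f ε

/-- The Laplacian `Δ = D_1 + ⋯ + D_n`. -/
def laplacian (f : Cube n → X) (ε : Cube n) : X := ∑ j : Fin n, D 𝕜 j f ε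

/-- The Walsh function `w_A(ε) = ∏_{i ∈ A} ε_i`. -/
def walsh (A : Finset (Fin n)) (ε : Cube n) : 𝕜 := ∏ i ∈ A, sgn 𝕜 (ε i)

/-- The Walsh coefficient `E (w_A f)`. -/
def walshCoeff (f : Cube n → X) (A : Finset (Fin n)) : X :=
  mean 𝕜 fun ε : Cube n => walsh 𝕜 A ε • f ε

/-- `Δ⁻¹`, the inverse of the Laplacian on functions of mean zero (and zero on constants):
since `Δ w_A = |A| w_A`, it multiplies the Walsh coefficient at `A ≠ ∅` by `1 / |A|`. -/
def invLaplacian (f : Cube n → X) (ε : Cube n) : X :=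
  ∑ A ∈ (Finset.univ : Finset (Finset (Fin n))).erase ∅,
    ((A.card : 𝕜)⁻¹ * walsh 𝕜 A ε) • walshCoeff 𝕜 f A

/-- `F_j(ε) = E_δ δ_j F(ε, δ)`. -/
def rademacherCoeff (F : Cube n → Cube n → X) (j : Fin n) (ε : Cube n) : X :=
  mean 𝕜 fun δ : Cube n => sgn 𝕜 (δ j) • F ε δ

end Operators

/-- `(E ‖f‖^p)^{1/p}` for a function on the cube. -/
def pNorm {X : Type v} [NormedAddCommGroup X] {n : ℕ} (p : ℝ) (f : Cube n → X) : ℝ :=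
  (mean ℝ fun ε : Cube n => ‖f ε‖ ^ p) ^ (1 / p)

/-- `(E_ε E_δ ‖F‖^p)^{1/p}` for a function on the product of two copies of the cube. -/
def pNorm₂ {X : Type v} [NormedAddCommGroup X] {n : ℕ} (p : ℝ) (F : Cube n → Cube n → X) : ℝ :=
  (mean ℝ fun ε : Cube n => mean ℝ fun δ : Cube n => ‖F ε δ‖ ^ p) ^ (1 / p)

/-- `X` has Rademacher cotype `q` (for finite `q`). -/
def HasCotype (𝕜 : Type u) [RCLike 𝕜] (X : Type v) [NormedAddCommGroup X] [NormedSpace 𝕜 X]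
    (q : ℝ) : Prop :=
  ∃ T : ℝ, ∀ (m : ℕ) (x : Fin m → X),
    (∑ i, ‖x i‖ ^ q) ^ (1 / q) ≤ T * pNorm q (fun δ : Cube m => ∑ i, sgn 𝕜 (δ i) • x i)

/-- The inequality `(E_ε ‖∑_j Δ⁻¹ D_j F_j‖^p)^{1/p} ≤ K (E_{ε,δ} ‖F‖^p)^{1/p}` holds for all
`F : {-1,1}^n × {-1,1}^n → X`. -/
def RieszSumBound (𝕜 : Type u) [RCLike 𝕜] (X : Type v) [NormedAddCommGroup X] [NormedSpace 𝕜 X]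
    (p : ℝ) (n : ℕ) (K : ℝ) : Prop :=
  ∀ F : Cube n → Cube n → X,
    pNorm p (fun ε : Cube n => ∑ j, invLaplacian 𝕜 (D 𝕜 j (rademacherCoeff 𝕜 F j)) ε)
      ≤ K * pNorm₂ p F

/-- The inequality `(E_{ε,δ} ‖∑_j δ_j Δ⁻¹ D_j g‖^p)^{1/p} ≤ K (E_ε ‖g‖^p)^{1/p}` holds for all
`g : {-1,1}^n → Y`. -/
def RieszTransformBound (𝕜 : Type u) [RCLike 𝕜] (Y : Type v) [NormedAddCommGroup Y]
    [NormedSpace 𝕜 Y] (p : ℝ) (n : ℕ) (K : ℝ) : Prop :=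
  ∀ g : Cube n → Y,
    pNorm₂ p (fun ε δ : Cube n => ∑ j, sgn 𝕜 (δ j) • invLaplacian 𝕜 (D 𝕜 j g) ε)
      ≤ K * pNorm p g

end HammingCube

end

/-! By its Walsh multiplier, `Δ⁻¹ D_j` is convolution on the cube with a scalar kernel k_j
(`rieszKernel`), so both (F1) and (dF) are governed by the random kernel k(x, δ) = ∑ δ_j k_j(x)
(`randomKernel`).

Upper bound. Khintchine bounds the L^p(δ)-norm of k(x, ·) by a constant times (∑ k_j(x)²)^{1/2}. A
Young-type convolution inequality (`mean_convolution_rpow_le`) then leaves only E_x (∑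
k_j(x)²)^{1/2} = O(√n) to prove. Since 1/|A| = ∫₀¹ r^{|A|-1} dr, the kernel k_j is the integral over
r of μ_r(x) (x_j - r)/(1 - r²), where μ_r is the product density under which every coordinate has
mean r and variance 1 - r². Cauchy–Schwarz bounds the mean ℓ²-norm at level r by √n (1 - r²)^{-1/2},
which is integrable on [0, 1]. For (F1), Hölder in δ moves Khintchine to the conjugate exponent.

Lower bound. Take X = ℓ¹ over the disjoint union of all cubes; it has cotype q because Khintchine
can be applied coordinatewise. Test (F1) on unit vectors at εδ, and (dF) on translates of the
majority function. Both reduce to the mean of k(x, δ) maj(xδ). Replacing δ by xδ and using E k_j(x)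
x_j = 1 turns this into E |∑ δ_j|, which is at least √n/20. -/

noncomputable section

namespace HammingCube

/-! ### Averages on the cube: Fubini, invariance, Jensen and Hölder. -/

section Mean

variable (𝕜 : Type u) [RCLike 𝕜] {X : Type v} [NormedAddCommGroup X] [NormedSpace 𝕜 X] {n : ℕ}

lemma card_cube (n : ℕ) : Fintype.card (Cube n) = 2 ^ n := by
  simp [Cube]

lemma mean_add (f g : Cube n → X) :
    mean 𝕜 (fun ε => f ε + g ε) = mean 𝕜 f + mean 𝕜 g := by
  simp [mean, Finset.sum_add_distrib]

lemma mean_sum {ι : Type*} (s : Finset ι) (f : ι → Cube n → X) :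
    mean 𝕜 (fun ε => ∑ i ∈ s, f i ε) = ∑ i ∈ s, mean 𝕜 (f i) := by
  simp only [mean]
  rw [Finset.sum_comm, Finset.smul_sum]

lemma mean_smul (c : 𝕜) (f : Cube n → X) : mean 𝕜 (fun ε => c • f ε) = c • mean 𝕜 f := by
  simp only [mean]
  rw [← Finset.smul_sum, smul_comm]

lemma mean_const (x : X) : mean 𝕜 (fun _ : Cube n => x) = x := by
  have h : (2 : 𝕜) ^ n ≠ 0 := pow_ne_zero _ two_ne_zero
  simp only [mean, Finset.sum_const, Finset.card_univ, card_cube]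
  rw [← Nat.cast_smul_eq_nsmul 𝕜, smul_smul]
  push_cast
  rw [inv_mul_cancel₀ h, one_smul]

lemma mean_comm {m : ℕ} (f : Cube n → Cube m → X) :
    mean 𝕜 (fun ε => mean 𝕜 (f ε)) = mean 𝕜 fun δ => mean 𝕜 fun ε => f ε δ := by
  simp only [mean]
  rw [← Finset.smul_sum, ← Finset.smul_sum, Finset.sum_comm, smul_comm]

/-- The uniform measure on the cube is invariant under translations. -/
lemma mean_mul_left (ε : Cube n) (f : Cube n → X) : mean 𝕜 (fun x => f (ε * x)) = mean 𝕜 f := by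
  simp only [mean]
  congr 1
  exact Fintype.sum_equiv (Equiv.mulLeft ε) _ f fun _ => rfl

lemma mean_apply_clm {Y : Type*} [NormedAddCommGroup Y] [NormedSpace 𝕜 Y] (L : X →L[𝕜] Y)
    (f : Cube n → X) : L (mean 𝕜 f) = mean 𝕜 fun ε => L (f ε) := by
  simp [mean, map_sum]

lemma norm_mean_le (f : Cube n → X) : ‖mean 𝕜 f‖ ≤ mean ℝ fun ε => ‖f ε‖ := by
  simp only [mean, norm_smul, norm_inv, norm_pow, RCLike.norm_ofNat, smul_eq_mul]
  gcongr
  exact norm_sum_le _ _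

lemma mean_ofReal (r : Cube n → ℝ) : mean 𝕜 (fun ε => ((r ε : ℝ) : 𝕜)) = ((mean ℝ r : ℝ) : 𝕜) := by
  simp only [mean, smul_eq_mul]
  push_cast
  rfl

lemma mean_mono {f g : Cube n → ℝ} (h : ∀ ε, f ε ≤ g ε) : mean ℝ f ≤ mean ℝ g := by
  simp only [mean, smul_eq_mul]
  gcongr
  exact h _

lemma mean_nonneg {f : Cube n → ℝ} (h : ∀ ε, 0 ≤ f ε) : 0 ≤ mean ℝ f := by
  simp only [mean, smul_eq_mul]
  have := Finset.sum_nonneg fun ε (_ : ε ∈ Finset.univ) => h ε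
  positivity

lemma mean_const_mul (c : ℝ) (f : Cube n → ℝ) : mean ℝ (fun ε => c * f ε) = c * mean ℝ f :=
  mean_smul ℝ c f

lemma mean_mul_const (c : ℝ) (f : Cube n → ℝ) : mean ℝ (fun ε => f ε * c) = mean ℝ f * c := by
  simp only [mul_comm _ c, mean_const_mul]

lemma mean_sub (f g : Cube n → X) :
    mean 𝕜 (fun ε => f ε - g ε) = mean 𝕜 f - mean 𝕜 g := by
  simp [mean, Finset.sum_sub_distrib, smul_sub]

/-- Expectations of products over the coordinates factor. -/
lemma mean_prod (φ : Fin n → ℤˣ → ℝ) :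
    mean ℝ (fun ε : Cube n => ∏ i, φ i (ε i)) = ∏ i, ((φ i 1 + φ i (-1)) / 2) := by
  have h : ∑ ε : Cube n, ∏ i, φ i (ε i) = ∏ i, ∑ s, φ i s := by
    rw [Finset.prod_univ_sum, Fintype.piFinset_univ]
  simp only [mean, smul_eq_mul, h, UnitsInt.univ]
  rw [Finset.prod_div_distrib, Finset.prod_const, Finset.card_univ, Fintype.card_fin,
    inv_mul_eq_div]
  congr 1
  refine Finset.prod_congr rfl fun i _ => ?_
  rw [Finset.sum_pair (by decide)]

/-- Weighted Jensen inequality. -/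
lemma rpow_mean_mul_le {p : ℝ} (hp : 1 ≤ p) {w v : Cube n → ℝ} (hw : ∀ x, 0 ≤ w x)
    (hv : ∀ x, 0 ≤ v x) :
    (mean ℝ fun x => w x * v x) ^ p ≤
      (mean ℝ w) ^ (p - 1) * mean ℝ fun x => w x * v x ^ p := by
  have hp0 : 0 < p := by linarith
  have hW := mean_nonneg hw
  have hV : 0 ≤ mean ℝ fun x => w x * v x ^ p :=
    mean_nonneg fun x => mul_nonneg (hw x) (Real.rpow_nonneg (hv x) p)
  have h := Real.inner_le_weight_mul_Lp_of_nonneg Finset.univ hp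
    (fun x => ((2 : ℝ) ^ n)⁻¹ * w x) v (fun x => by have := hw x; positivity) hv
  simp only [mul_assoc, ← Finset.mul_sum] at h
  -- The factor `2 ^ (-n)` was put into the weight, so the weighted sums are means by definition.
  have h' : (mean ℝ fun x => w x * v x) ≤
      (mean ℝ w) ^ (1 - p⁻¹) * (mean ℝ fun x => w x * v x ^ p) ^ p⁻¹ := h
  calc _ ≤ ((mean ℝ w) ^ (1 - p⁻¹) * (mean ℝ fun x => w x * v x ^ p) ^ p⁻¹) ^ p :=
        Real.rpow_le_rpow (mean_nonneg fun x => mul_nonneg (hw x) (hv x)) h' hp0.le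
    _ = _ := by
        rw [Real.mul_rpow (Real.rpow_nonneg hW _) (Real.rpow_nonneg hV _), ← Real.rpow_mul hW,
          ← Real.rpow_mul hV, inv_mul_cancel₀ hp0.ne', Real.rpow_one]
        congr 2
        field_simp

lemma rpow_mean_le {p : ℝ} (hp : 1 ≤ p) {v : Cube n → ℝ} (hv : ∀ x, 0 ≤ v x) :
    (mean ℝ v) ^ p ≤ mean ℝ fun x => v x ^ p := by
  simpa [mean_const] using rpow_mean_mul_le hp (w := fun _ => 1) (fun _ => zero_le_one) hv

/-- Hölder's inequality. -/
lemma mean_mul_le {p q : ℝ} (hpq : p.HolderConjugate q) {f g : Cube n → ℝ} (hf : ∀ x, 0 ≤ f x)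
    (hg : ∀ x, 0 ≤ g x) :
    (mean ℝ fun x => f x * g x) ≤
      (mean ℝ fun x => f x ^ p) ^ (1 / p) * (mean ℝ fun x => g x ^ q) ^ (1 / q) := by
  have h := Real.inner_le_Lp_mul_Lq_of_nonneg Finset.univ hpq (fun x _ => hf x) (fun x _ => hg x)
  have h2 : (0 : ℝ) ≤ ((2 : ℝ) ^ n)⁻¹ := by positivity
  simp only [mean, smul_eq_mul]
  rw [Real.mul_rpow h2 (Finset.sum_nonneg fun x _ => Real.rpow_nonneg (hf x) _),
    Real.mul_rpow h2 (Finset.sum_nonneg fun x _ => Real.rpow_nonneg (hg x) _),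
    mul_mul_mul_comm, ← Real.rpow_add (by positivity), one_div, one_div, hpq.inv_add_inv_eq_one,
    Real.rpow_one]
  simp only [one_div] at h
  exact mul_le_mul_of_nonneg_left h h2

lemma mean_norm_le_pNorm {p : ℝ} (hp : 1 ≤ p) (f : Cube n → X) :
    (mean ℝ fun ε => ‖f ε‖) ≤ pNorm p f := by
  have hp0 : 0 < p := by linarith
  have h := rpow_mean_le hp fun ε => norm_nonneg (f ε)
  have h0 := mean_nonneg fun ε => norm_nonneg (f ε)
  rw [pNorm, one_div, Real.le_rpow_inv_iff_of_pos h0 (le_trans (Real.rpow_nonneg h0 p) h) hp0]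
  exact h

lemma mean_norm_le_pNorm₂ {p : ℝ} (hp : 1 ≤ p) (F : Cube n → Cube n → X) :
    (mean ℝ fun ε => mean ℝ fun δ => ‖F ε δ‖) ≤ pNorm₂ p F := by
  have hp0 : 0 < p := by linarith
  have h0 := mean_nonneg fun ε => mean_nonneg fun δ => norm_nonneg (F ε δ)
  have h : (mean ℝ fun ε => mean ℝ fun δ => ‖F ε δ‖) ^ p ≤
      mean ℝ fun ε => mean ℝ fun δ => ‖F ε δ‖ ^ p :=
    (rpow_mean_le hp fun ε => mean_nonneg fun δ => norm_nonneg (F ε δ)).trans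
      (mean_mono fun ε => rpow_mean_le hp fun δ => norm_nonneg (F ε δ))
  rw [pNorm₂, one_div, Real.le_rpow_inv_iff_of_pos h0 (le_trans (Real.rpow_nonneg h0 p) h) hp0]
  exact h

end Mean

/-! ### Signs and characters. -/

section Sign

variable (𝕜 : Type u) [RCLike 𝕜]

@[simp] lemma sgn_one : sgn 𝕜 1 = 1 := by simp [sgn]

@[simp] lemma sgn_neg_one : sgn 𝕜 (-1) = -1 := by simp [sgn]

lemma sgn_mul (s t : ℤˣ) : sgn 𝕜 (s * t) = sgn 𝕜 s * sgn 𝕜 t := by simp [sgn]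

lemma sgn_sq (s : ℤˣ) : sgn 𝕜 s ^ 2 = 1 := by
  rcases Int.units_eq_one_or s with rfl | rfl <;> simp

lemma sgn_mul_self (s : ℤˣ) : sgn 𝕜 s * sgn 𝕜 s = 1 := by
  rw [← sq, sgn_sq]

lemma ofReal_sgn (s : ℤˣ) : ((sgn ℝ s : ℝ) : 𝕜) = sgn 𝕜 s := by simp [sgn]

lemma cube_mul_self {n : ℕ} (ε : Cube n) : ε * ε = 1 := by
  funext i
  exact Int.units_mul_self (ε i)

lemma walsh_mul {n : ℕ} (A : Finset (Fin n)) (ε x : Cube n) :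
    walsh 𝕜 A (ε * x) = walsh 𝕜 A ε * walsh 𝕜 A x := by
  simp [walsh, sgn_mul, Finset.prod_mul_distrib]

lemma ofReal_walsh {n : ℕ} (A : Finset (Fin n)) (x : Cube n) :
    ((walsh ℝ A x : ℝ) : 𝕜) = walsh 𝕜 A x := by
  simp [walsh, ofReal_sgn]

end Sign

/-! ### Khintchine inequalities from exponential moments. -/

section Khintchine

variable {n : ℕ}

/-- The Rademacher sum with real coefficients `a`. -/
def rademacherSum (a : Fin n → ℝ) (δ : Cube n) : ℝ := ∑ j, sgn ℝ (δ j) * a j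

lemma rademacherSum_smul (c : ℝ) (a : Fin n → ℝ) (δ : Cube n) :
    rademacherSum (fun j => c * a j) δ = c * rademacherSum a δ := by
  simp only [rademacherSum, Finset.mul_sum]
  exact Finset.sum_congr rfl fun j _ => by ring

/-- Independence factors the mean into a product of cosh(a_j), and cosh t ≤ exp(t²/2). -/
lemma mean_exp_rademacherSum_le (a : Fin n → ℝ) :
    mean ℝ (fun δ => Real.exp (rademacherSum a δ)) ≤ Real.exp ((∑ j, a j ^ 2) / 2) := by
  have h : ∀ δ : Cube n, Real.exp (rademacherSum a δ) = ∏ j, Real.exp (sgn ℝ (δ j) * a j) :=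
    fun δ => by rw [rademacherSum, Real.exp_sum]
  simp only [h]
  rw [mean_prod fun j s => Real.exp (sgn ℝ s * a j), Finset.sum_div, Real.exp_sum]
  refine Finset.prod_le_prod (fun j _ => by positivity) fun j _ => ?_
  have := Real.cosh_le_exp_half_sq (a j)
  rw [Real.cosh_eq] at this
  simpa using this

lemma mean_exp_abs_rademacherSum_le (a : Fin n → ℝ) (ha : ∑ j, a j ^ 2 = 1) :
    mean ℝ (fun δ => Real.exp |rademacherSum a δ|) ≤ 4 := by
  have h1 := mean_exp_rademacherSum_le a
  have h2 := mean_exp_rademacherSum_le fun j => (-1) * a j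
  simp only [rademacherSum_smul] at h2
  simp only [mul_pow, even_two, Even.neg_pow, one_pow, one_mul, ha] at h1 h2
  have h3 : Real.exp (1 / 2) ≤ 2 := by
    have h := Real.exp_one_lt_d9
    have h' : Real.exp (1 / 2) ^ 2 = Real.exp 1 := by
      rw [← Real.exp_nat_mul]; norm_num
    nlinarith [Real.exp_pos (1 / 2)]
  calc _ ≤ mean ℝ (fun δ => Real.exp (rademacherSum a δ) + Real.exp (-1 * rademacherSum a δ)) := by
        refine mean_mono fun δ => ?_
        rcases abs_choice (rademacherSum a δ) with h | h <;> rw [h]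
        · linarith [Real.exp_pos (-1 * rademacherSum a δ)]
        · rw [neg_one_mul]
          linarith [Real.exp_pos (rademacherSum a δ)]
    _ ≤ 4 := by rw [mean_add]; linarith

/-- An upper Khintchine constant, up to taking a `p`-th root. -/
def khintchineConst (p : ℝ) : ℝ := 1 + 4 * (⌈p⌉₊.factorial : ℝ)

lemma one_le_khintchineConst (p : ℝ) : 1 ≤ khintchineConst p := by
  unfold khintchineConst
  have : (0 : ℝ) ≤ 4 * (⌈p⌉₊.factorial : ℝ) := by positivity
  linarith

lemma rademacherSum_eq_zero {a : Fin n → ℝ} (ha : ∑ j, a j ^ 2 = 0) (δ : Cube n) :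
    rademacherSum a δ = 0 := by
  have h := (Finset.sum_eq_zero_iff_of_nonneg fun j _ => sq_nonneg (a j)).1 ha
  refine Finset.sum_eq_zero fun j hj => ?_
  rw [pow_eq_zero_iff (two_ne_zero)|>.1 (h j hj), mul_zero]

lemma sum_sq_div_sqrt (a : Fin n → ℝ) (ha : ∑ j, a j ^ 2 ≠ 0) :
    ∑ j, ((√(∑ j, a j ^ 2))⁻¹ * a j) ^ 2 = 1 := by
  simp only [mul_pow, ← Finset.mul_sum, inv_pow]
  rw [Real.sq_sqrt (Finset.sum_nonneg fun j _ => sq_nonneg (a j)), inv_mul_cancel₀ ha]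

lemma mean_abs_rademacherSum_rpow_le_of_normalized {p : ℝ} (hp : 0 ≤ p) (a : Fin n → ℝ)
    (ha : ∑ j, a j ^ 2 = 1) :
    mean ℝ (fun δ => |rademacherSum a δ| ^ p) ≤ khintchineConst p := by
  -- For t ≤ 1 the summand 1 suffices; for t ≥ 1 the exponent is rounded up and one term of the
  -- exponential series is used.
  have key : ∀ t : ℝ, 0 ≤ t → t ^ p ≤ 1 + ⌈p⌉₊.factorial * Real.exp t := by
    intro t ht
    have h1 : t ^ ⌈p⌉₊ ≤ ⌈p⌉₊.factorial * Real.exp t := by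
      have := Real.pow_div_factorial_le_exp t ht ⌈p⌉₊
      rwa [div_le_iff₀' (by positivity)] at this
    rcases le_total t 1 with h | h
    · have := Real.rpow_le_one ht h hp
      have : 0 ≤ t ^ ⌈p⌉₊ := by positivity
      linarith
    · have := Real.rpow_le_rpow_of_exponent_le h (Nat.le_ceil p)
      rw [Real.rpow_natCast] at this
      linarith
  calc _ ≤ mean ℝ (fun δ => 1 + ⌈p⌉₊.factorial * Real.exp |rademacherSum a δ|) :=
        mean_mono fun δ => key _ (abs_nonneg _)
    _ ≤ _ := by
        rw [mean_add, mean_const, mean_const_mul, khintchineConst, mul_comm (4 : ℝ)]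
        gcongr
        exact mean_exp_abs_rademacherSum_le a ha

/-- The upper Khintchine inequality. -/
lemma mean_abs_rademacherSum_rpow_le {p : ℝ} (hp : 0 < p) (a : Fin n → ℝ) :
    mean ℝ (fun δ => |rademacherSum a δ| ^ p) ≤ khintchineConst p * √(∑ j, a j ^ 2) ^ p := by
  by_cases ha : ∑ j, a j ^ 2 = 0
  · simp [rademacherSum_eq_zero ha, ha, Real.zero_rpow hp.ne', mean_const]
  · have hσ : 0 < √(∑ j, a j ^ 2) := Real.sqrt_pos.2
      (lt_of_le_of_ne (Finset.sum_nonneg fun j _ => sq_nonneg (a j)) (Ne.symm ha))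
    have h := mean_abs_rademacherSum_rpow_le_of_normalized hp.le _ (sum_sq_div_sqrt a ha)
    simp only [rademacherSum_smul, abs_mul, abs_inv, abs_of_pos hσ] at h
    simp only [Real.mul_rpow (inv_nonneg.2 hσ.le) (abs_nonneg _), mean_const_mul,
      Real.inv_rpow hσ.le] at h
    rwa [inv_mul_le_iff₀ (Real.rpow_pos_of_pos hσ p), mul_comm] at h

lemma mean_sgn_mul_sgn (i j : Fin n) :
    mean ℝ (fun δ : Cube n => sgn ℝ (δ i) * sgn ℝ (δ j)) = if i = j then 1 else 0 := by
  split_ifs with h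
  · subst h
    simp [sgn_mul_self, mean_const]
  · have h' := mean_prod fun k s =>
      (if k = i then sgn ℝ s else 1) * (if k = j then sgn ℝ s else 1)
    simp only [Finset.prod_mul_distrib, Finset.prod_ite_eq', Finset.mem_univ, if_true] at h'
    rw [h']
    refine Finset.prod_eq_zero (Finset.mem_univ i) ?_
    simp [h]

lemma mean_rademacherSum_sq (a : Fin n → ℝ) :
    mean ℝ (fun δ => rademacherSum a δ ^ 2) = ∑ j, a j ^ 2 := by
  have h : ∀ δ : Cube n, rademacherSum a δ ^ 2 =
      ∑ i, ∑ j, (a i * a j) * (sgn ℝ (δ i) * sgn ℝ (δ j)) := fun δ => by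
    rw [sq, rademacherSum, Finset.sum_mul_sum]
    exact Finset.sum_congr rfl fun i _ => Finset.sum_congr rfl fun j _ => by ring
  simp only [h, mean_sum, mean_const_mul, mean_sgn_mul_sgn]
  simp [sq]

/-- The lower Khintchine inequality in `L¹`. -/
lemma sqrt_le_mean_abs_rademacherSum (a : Fin n → ℝ) :
    (1 / 20) * √(∑ j, a j ^ 2) ≤ mean ℝ (fun δ => |rademacherSum a δ|) := by
  by_cases ha : ∑ j, a j ^ 2 = 0
  · rw [ha, Real.sqrt_zero, mul_zero]
    exact mean_nonneg fun δ => abs_nonneg _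
  have hσ : 0 < √(∑ j, a j ^ 2) := Real.sqrt_pos.2
      (lt_of_le_of_ne (Finset.sum_nonneg fun j _ => sq_nonneg (a j)) (Ne.symm ha))
  have hb := sum_sq_div_sqrt a ha
  have h2 := mean_rademacherSum_sq fun j => (√(∑ j, a j ^ 2))⁻¹ * a j
  have hexp := mean_exp_abs_rademacherSum_le _ hb
  rw [hb] at h2
  -- Averaging this for a normalized sum gives at least 1/5 - 4/27 = 7/135, which exceeds 1/20.
  have key : ∀ t : ℝ, (1 / 5) * t ^ 2 - (1 / 27) * Real.exp |t| ≤ |t| := by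
    intro t
    have h4 := Real.pow_div_factorial_le_exp |t| (abs_nonneg t) 4
    rw [show ((4 : ℕ).factorial : ℝ) = 24 by norm_num [Nat.factorial]] at h4
    rw [← sq_abs t]
    set s := |t|
    have hs : 0 ≤ s := abs_nonneg t
    -- With exp s ≥ s⁴/24 the claim reduces to s³ - 129.6 s + 648 ≥ 0. The double root 33/5 lies
    -- close to the minimum of this cubic.
    have h1 : 0 ≤ s * ((s - 33 / 5) ^ 2 * (s + 66 / 5)) := by positivity
    nlinarith [Real.exp_pos s]
  have h3 : mean ℝ (fun δ => (1 / 5) * rademacherSum (fun j => (√(∑ j, a j ^ 2))⁻¹ * a j) δ ^ 2 -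
      (1 / 27) * Real.exp |rademacherSum (fun j => (√(∑ j, a j ^ 2))⁻¹ * a j) δ|) ≤ _ :=
    mean_mono fun δ => key _
  rw [mean_sub, mean_const_mul, mean_const_mul, h2] at h3
  simp only [rademacherSum_smul, abs_mul, abs_inv, abs_of_pos hσ, mean_const_mul] at h3 hexp
  have h5 : 1 / 20 ≤ (√(∑ j, a j ^ 2))⁻¹ * mean ℝ (fun δ => |rademacherSum a δ|) := by linarith
  rwa [le_inv_mul_iff₀ hσ, mul_comm] at h5

end Khintchine

/-! ### The Riesz kernels and their mean ℓ²-norm. -/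

section Kernel

variable {n : ℕ}

/-- The convolution kernel of `Δ⁻¹ D_j`. -/
def rieszKernel (j : Fin n) (x : Cube n) : ℝ :=
  ∑ A : Finset (Fin n), if j ∈ A then (A.card : ℝ)⁻¹ * walsh ℝ A x else 0

variable (𝕜 : Type u) [RCLike 𝕜] {X : Type v} [NormedAddCommGroup X] [NormedSpace 𝕜 X]

/-- Reflection of the `j`-th coordinate. -/
def flip (j : Fin n) : Cube n := Function.update 1 j (-1)

lemma D_apply (j : Fin n) (f : Cube n → X) (ε : Cube n) :
    D 𝕜 j f ε = (2 : 𝕜)⁻¹ • (f ε - f (flip j * ε)) := by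
  have hu : ∀ s : ℤˣ, Function.update ε j (s * ε j) = Function.update (1 : Cube n) j s * ε := by
    intro s
    funext i
    by_cases h : i = j
    · subst h; simp
    · simp [h]
  have h1 := hu 1
  have h2 := hu (-1)
  simp only [one_mul, Function.update_eq_self] at h1 h2
  rw [D, partialDeriv, flip, ← h2]
  rcases Int.units_eq_one_or (ε j) with h | h <;> rw [h]
  · have h3 : Function.update ε j 1 = ε := by rw [← h, Function.update_eq_self]
    simp [h3]
  · have h3 : Function.update ε j (-1) = ε := by
      conv_rhs => rw [← Function.update_eq_self j ε, h]
    rw [h3]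
    simp [← smul_neg]

lemma walsh_flip (j : Fin n) (A : Finset (Fin n)) :
    walsh 𝕜 A (flip j) = if j ∈ A then -1 else 1 := by
  have h : ∀ i, sgn 𝕜 (flip j i) = if i = j then -1 else 1 := by
    intro i
    by_cases h : i = j
    · subst h; simp [flip]
    · simp [flip, h]
  simp only [walsh, h, Finset.prod_ite_eq']

lemma walshCoeff_D (j : Fin n) (f : Cube n → X) (A : Finset (Fin n)) :
    walshCoeff 𝕜 (D 𝕜 j f) A = if j ∈ A then walshCoeff 𝕜 f A else 0 := by
  have h : mean 𝕜 (fun ε => walsh 𝕜 A ε • f (flip j * ε)) =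
      (if j ∈ A then (-1 : 𝕜) else 1) • walshCoeff 𝕜 f A := by
    rw [← mean_mul_left 𝕜 (flip j), walshCoeff, ← mean_smul]
    congr 1
    funext ε
    rw [walsh_mul, walsh_flip, ← mul_assoc, cube_mul_self, one_mul, mul_smul]
  have h' : walshCoeff 𝕜 (D 𝕜 j f) A =
      (2 : 𝕜)⁻¹ • (walshCoeff 𝕜 f A - mean 𝕜 (fun ε => walsh 𝕜 A ε • f (flip j * ε))) := by
    simp only [walshCoeff, D_apply]
    rw [← mean_sub, ← mean_smul]
    congr 1
    funext ε
    rw [smul_comm, smul_sub]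
  rw [h', h]
  split_ifs
  · rw [neg_one_smul, sub_neg_eq_add, ← two_smul 𝕜, smul_smul, inv_mul_cancel₀ two_ne_zero,
      one_smul]
  · simp

/-- `Δ⁻¹ D_j` is the convolution with `rieszKernel j`. -/
lemma invLaplacian_D (j : Fin n) (f : Cube n → X) (ε : Cube n) :
    invLaplacian 𝕜 (D 𝕜 j f) ε = mean 𝕜 fun x => ((rieszKernel j x : ℝ) : 𝕜) • f (ε * x) := by
  have h1 : invLaplacian 𝕜 (D 𝕜 j f) ε = ∑ A : Finset (Fin n),
      (if j ∈ A then (A.card : 𝕜)⁻¹ * walsh 𝕜 A ε else 0) • walshCoeff 𝕜 f A := by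
    rw [invLaplacian, ← Finset.add_sum_erase Finset.univ _ (Finset.mem_univ ∅)]
    simp only [Finset.notMem_empty, if_false, zero_smul, zero_add, walshCoeff_D]
    refine Finset.sum_congr rfl fun A _ => ?_
    split_ifs <;> simp
  have h2 : ∀ x, ((rieszKernel j x : ℝ) : 𝕜) = ∑ A : Finset (Fin n),
      if j ∈ A then (A.card : 𝕜)⁻¹ * walsh 𝕜 A x else 0 := by
    intro x
    rw [rieszKernel, RCLike.ofReal_sum]
    refine Finset.sum_congr rfl fun A _ => ?_
    split_ifs <;> simp [ofReal_walsh]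
  rw [h1, ← mean_mul_left 𝕜 ε]
  simp only [h2, Finset.sum_smul, mean_sum, ← mul_assoc, cube_mul_self, one_mul]
  refine Finset.sum_congr rfl fun A _ => ?_
  rw [walshCoeff, ← mean_smul]
  congr 1
  funext x
  rw [walsh_mul, smul_smul]
  split_ifs <;> simp [mul_assoc]

/-- The density of the noise operator, with the `j`-th factor replaced by `x_j`. -/
def noiseDeriv (j : Fin n) (x : Cube n) (r : ℝ) : ℝ :=
  sgn ℝ (x j) * ∏ i ∈ Finset.univ.erase j, (1 + r * sgn ℝ (x i))

/-- Expanding the product over subsets B avoiding j, the sign of x_j turns B into A = B ∪ {j}, so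
the power of r is |B| = |A| - 1. -/
lemma noiseDeriv_eq_sum (j : Fin n) (x : Cube n) (r : ℝ) :
    noiseDeriv j x r =
      ∑ A : Finset (Fin n), if j ∈ A then r ^ (A.card - 1) * walsh ℝ A x else 0 := by
  have hj : j ∉ Finset.univ.erase j := Finset.notMem_erase _ _
  have hu : (Finset.univ : Finset (Finset (Fin n))) =
      (insert j (Finset.univ.erase j)).powerset := by
    rw [Finset.insert_erase (Finset.mem_univ j), Finset.powerset_univ]
  rw [hu, Finset.sum_powerset_insert hj, noiseDeriv, Finset.prod_one_add, Finset.mul_sum,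
    ← Finset.sum_add_distrib]
  refine Finset.sum_congr rfl fun B hB => ?_
  have hjB : j ∉ B := fun h => hj (Finset.mem_powerset.1 hB h)
  rw [if_neg hjB, if_pos (Finset.mem_insert_self j B), Finset.card_insert_of_notMem hjB, walsh,
    Finset.prod_insert hjB, Finset.prod_mul_distrib, Finset.prod_const]
  simp only [Nat.add_sub_cancel]
  ring

/-- Restores the missing j-th factor of the product density: (x_j - r)(1 + r x_j) = (1 - r²) x_j
because x_j² = 1. -/
lemma one_sub_sq_mul_noiseDeriv (j : Fin n) (x : Cube n) (r : ℝ) :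
    (1 - r ^ 2) * noiseDeriv j x r = (sgn ℝ (x j) - r) * ∏ i, (1 + r * sgn ℝ (x i)) := by
  rw [noiseDeriv, ← Finset.mul_prod_erase Finset.univ _ (Finset.mem_univ j)]
  have := sgn_sq ℝ (x j)
  linear_combination (-r * (∏ i ∈ Finset.univ.erase j, (1 + r * sgn ℝ (x i)))) * this

lemma continuous_noiseDeriv (j : Fin n) (x : Cube n) : Continuous (noiseDeriv j x) := by
  unfold noiseDeriv
  fun_prop

/-- This is ∫₀¹ r^{k-1} dr after r = 1 - s². The Jacobian 2s cancels the (1 - r)^{-1/2} singularity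
of the later norm estimate, which becomes uniform in s. -/
lemma integral_two_mul_mul_one_sub_sq_pow (k : ℕ) (hk : k ≠ 0) :
    ∫ s in (0 : ℝ)..1, 2 * s * (1 - s ^ 2) ^ (k - 1) = (k : ℝ)⁻¹ := by
  have hk' : (k : ℝ) ≠ 0 := by exact_mod_cast hk
  have h : ∀ s ∈ Set.uIcc (0 : ℝ) 1,
      HasDerivAt (fun s : ℝ => -(k : ℝ)⁻¹ * (1 - s ^ 2) ^ k) (2 * s * (1 - s ^ 2) ^ (k - 1)) s := by
    intro s _
    have h1 := ((((hasDerivAt_id s).pow 2).const_sub 1).pow k).const_mul (-(k : ℝ)⁻¹)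
    refine h1.congr_deriv ?_
    simp
    field_simp
  rw [intervalIntegral.integral_eq_sub_of_hasDerivAt h
    (Continuous.intervalIntegrable (by fun_prop) _ _)]
  simp [hk]

lemma rieszKernel_eq_integral (j : Fin n) (x : Cube n) :
    rieszKernel j x = ∫ s in (0 : ℝ)..1, 2 * s * noiseDeriv j x (1 - s ^ 2) := by
  simp only [noiseDeriv_eq_sum, Finset.mul_sum]
  rw [intervalIntegral.integral_finsetSum]
  · refine Finset.sum_congr rfl fun A _ => ?_
    split_ifs with h
    · rw [← integral_two_mul_mul_one_sub_sq_pow A.card (Finset.card_ne_zero_of_mem h)]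
      simp only [← mul_assoc, intervalIntegral.integral_mul_const]
    · simp
  · intro A _
    split_ifs
    · exact Continuous.intervalIntegrable (by fun_prop) _ _
    · simp

lemma mean_noise (r : ℝ) : mean ℝ (fun x : Cube n => ∏ i, (1 + r * sgn ℝ (x i))) = 1 := by
  rw [mean_prod fun _ s => 1 + r * sgn ℝ s]
  refine Finset.prod_eq_one fun i _ => ?_
  rw [sgn_one, sgn_neg_one]
  ring

/-- The variance of one coordinate under the product density of mean r. -/
lemma mean_noise_mul_sq (j : Fin n) (r : ℝ) :
    mean ℝ (fun x : Cube n => (∏ i, (1 + r * sgn ℝ (x i))) * (sgn ℝ (x j) - r) ^ 2) =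
      1 - r ^ 2 := by
  have h := mean_prod fun (i : Fin n) s =>
    (1 + r * sgn ℝ s) * (if i = j then (sgn ℝ s - r) ^ 2 else 1)
  simp only [Finset.prod_mul_distrib, Finset.prod_ite_eq', Finset.mem_univ, if_true] at h
  rw [h, ← Finset.mul_prod_erase Finset.univ _ (Finset.mem_univ j), Finset.prod_eq_one]
  · simp
    ring
  · intro i hi
    simp only [Finset.ne_of_mem_erase hi, if_false, sgn_one, sgn_neg_one]
    ring

lemma noise_nonneg (x : Cube n) {r : ℝ} (h0 : 0 ≤ r) (h1 : r ≤ 1) :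
    0 ≤ ∏ i, (1 + r * sgn ℝ (x i)) := by
  refine Finset.prod_nonneg fun i _ => ?_
  rcases Int.units_eq_one_or (x i) with h | h <;> rw [h] <;> simp <;> linarith

lemma mean_sqrt_sum_noiseDeriv_sq_le {s : ℝ} (h0 : 0 ≤ s) (h1 : s ≤ 1) :
    mean ℝ (fun x : Cube n => √(∑ j, (2 * s * noiseDeriv j x (1 - s ^ 2)) ^ 2)) ≤ 2 * √n := by
  -- At s = 0 one has r = 1, and division by 1 - r² would be meaningless.
  rcases h0.eq_or_lt with rfl | hs
  · simp [mean_const]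
  set r := 1 - s ^ 2 with hr
  have hr0 : 0 ≤ r := by nlinarith
  have hr1 : 0 < 1 - r ^ 2 := by nlinarith [mul_pos hs hs]
  -- Here 1 - r² = 2s² - s⁴, and s ≤ 1.
  have hs2 : s ^ 2 ≤ 1 - r ^ 2 := by nlinarith [mul_pos hs hs]
  have hrle : r ≤ 1 := by nlinarith
  set μ : Cube n → ℝ := fun x => ∏ i, (1 + r * sgn ℝ (x i)) with hμ
  have hμ0 : ∀ x, 0 ≤ μ x := fun x => noise_nonneg x hr0 hrle
  have e1 : ∀ x : Cube n, √(∑ j, (2 * s * noiseDeriv j x r) ^ 2) =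
      (2 * s / (1 - r ^ 2)) * (μ x * √(∑ j, (sgn ℝ (x j) - r) ^ 2)) := by
    intro x
    have : ∑ j, (2 * s * noiseDeriv j x r) ^ 2 =
        ((2 * s / (1 - r ^ 2)) * μ x) ^ 2 * ∑ j, (sgn ℝ (x j) - r) ^ 2 := by
      rw [Finset.mul_sum]
      refine Finset.sum_congr rfl fun j _ => ?_
      have h := one_sub_sq_mul_noiseDeriv j x r
      rw [← mul_pow]
      congr 1
      field_simp
      rw [mul_comm (noiseDeriv j x r), h]
      ring
    have h2 := hμ0 x
    rw [this, Real.sqrt_mul (sq_nonneg _), Real.sqrt_sq (by positivity), mul_assoc]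
  -- Jensen for the probability density μ, then the sum of the n variances.
  have e2 : mean ℝ (fun x => μ x * √(∑ j, (sgn ℝ (x j) - r) ^ 2)) ≤ √(n * (1 - r ^ 2)) := by
    have h := rpow_mean_mul_le one_le_two hμ0
      (v := fun x => √(∑ j, (sgn ℝ (x j) - r) ^ 2)) fun x => Real.sqrt_nonneg _
    rw [mean_noise, Real.one_rpow, one_mul] at h
    simp only [Real.rpow_ofNat, Real.sq_sqrt (Finset.sum_nonneg fun j _ => sq_nonneg _)] at h
    refine Real.le_sqrt_of_sq_le (h.trans (le_of_eq ?_))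
    simp only [Finset.mul_sum, mean_sum, hμ, mean_noise_mul_sq]
    simp only [Finset.sum_const, Finset.card_univ, Fintype.card_fin, nsmul_eq_mul]
  simp only [e1, mean_const_mul]
  calc _ ≤ (2 * s / (1 - r ^ 2)) * √(n * (1 - r ^ 2)) := by gcongr
    _ = 2 * √n * (s / √(1 - r ^ 2)) := by
      rw [Real.sqrt_mul (Nat.cast_nonneg n)]
      have h := Real.mul_self_sqrt hr1.le
      have h' : √(1 - r ^ 2) ≠ 0 := (Real.sqrt_pos.2 hr1).ne'
      field_simp
      rw [sq, h, mul_comm]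
    _ ≤ 2 * √n * 1 := by
      gcongr
      rw [div_le_one (Real.sqrt_pos.2 hr1)]
      exact Real.le_sqrt_of_sq_le hs2
    _ = 2 * √n := mul_one _

/-- Minkowski's integral inequality for functions with values in `ℓ²`. -/
lemma sqrt_sum_integral_sq_le (U : Fin n → ℝ → ℝ) (hU : ∀ j, Continuous (U j)) :
    √(∑ j, (∫ s in (0 : ℝ)..1, U j s) ^ 2) ≤ ∫ s in (0 : ℝ)..1, √(∑ j, U j s ^ 2) := by
  set k : Fin n → ℝ := fun j => ∫ s in (0 : ℝ)..1, U j s with hk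
  set S := ∑ j, k j ^ 2 with hS
  have hS0 : 0 ≤ S := Finset.sum_nonneg fun j _ => sq_nonneg _
  have hI : (0 : ℝ) ≤ ∫ s in (0 : ℝ)..1, √(∑ j, U j s ^ 2) :=
    intervalIntegral.integral_nonneg zero_le_one fun s _ => Real.sqrt_nonneg _
  -- Duality: pair the integrated vector with itself, apply Cauchy–Schwarz under the integral, and
  -- later divide by √S.
  have h1 : S ≤ √S * ∫ s in (0 : ℝ)..1, √(∑ j, U j s ^ 2) := by
    have e : S = ∫ s in (0 : ℝ)..1, ∑ j, k j * U j s := by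
      rw [intervalIntegral.integral_finsetSum]
      · simp only [intervalIntegral.integral_const_mul]
        exact Finset.sum_congr rfl fun j _ => sq (k j)
      · exact fun j _ => Continuous.intervalIntegrable (by have := hU j; fun_prop) _ _
    rw [← intervalIntegral.integral_const_mul]
    conv_lhs => rw [e]
    refine intervalIntegral.integral_mono_on zero_le_one
      (Continuous.intervalIntegrable (by fun_prop) _ _)
      (Continuous.intervalIntegrable (by fun_prop) _ _) fun s _ => ?_
    exact Real.sum_mul_le_sqrt_mul_sqrt _ _ _
  rcases hS0.eq_or_lt with h | h
  · rw [← h, Real.sqrt_zero]; exact hI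
  · have h2 := Real.sqrt_pos.2 h
    nlinarith [Real.mul_self_sqrt hS0]

/-- The `ℓ²`-norm of the Riesz kernels has mean `O(√n)`. -/
lemma mean_sqrt_sum_rieszKernel_sq_le :
    mean ℝ (fun x : Cube n => √(∑ j, rieszKernel j x ^ 2)) ≤ 2 * √n := by
  have hc : ∀ (x : Cube n) j, Continuous fun s : ℝ => 2 * s * noiseDeriv j x (1 - s ^ 2) := by
    intro x j
    have := continuous_noiseDeriv j x
    fun_prop
  have hc' : ∀ x : Cube n,
      Continuous fun s : ℝ => √(∑ j, (2 * s * noiseDeriv j x (1 - s ^ 2)) ^ 2) := by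
    intro x
    have := hc x
    fun_prop
  calc _ ≤ mean ℝ (fun x : Cube n =>
        ∫ s in (0 : ℝ)..1, √(∑ j, (2 * s * noiseDeriv j x (1 - s ^ 2)) ^ 2)) := by
        refine mean_mono fun x => ?_
        simp only [rieszKernel_eq_integral]
        exact sqrt_sum_integral_sq_le _ (hc x)
    _ = ∫ s in (0 : ℝ)..1,
        mean ℝ (fun x : Cube n => √(∑ j, (2 * s * noiseDeriv j x (1 - s ^ 2)) ^ 2)) := by
        simp only [mean, smul_eq_mul]
        rw [intervalIntegral.integral_const_mul, intervalIntegral.integral_finsetSum]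
        exact fun x _ => (hc' x).intervalIntegrable _ _
    _ ≤ ∫ s in (0 : ℝ)..1, 2 * √n := by
        refine intervalIntegral.integral_mono_on zero_le_one ?_ (by simp)
          fun s hs => mean_sqrt_sum_noiseDeriv_sq_le hs.1 hs.2
        refine Continuous.intervalIntegrable ?_ _ _
        simp only [mean, smul_eq_mul]
        exact continuous_const.mul (continuous_finsetSum _ fun x _ => hc' x)
    _ = 2 * √n := by simp

end Kernel

/-! ### The O(√n) bounds. -/

section UpperBound

variable {n : ℕ}

/-- A form of Young's convolution inequality on the cube, with an auxiliary random factor `κ`. -/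
lemma mean_convolution_rpow_le {p : ℝ} (hp : 1 ≤ p) {w φ : Cube n → ℝ} {κ : Cube n → Cube n → ℝ}
    (hw : ∀ x, 0 ≤ w x) (hφ : ∀ x, 0 ≤ φ x) (hκ : ∀ x δ, 0 ≤ κ x δ)
    (hκ1 : ∀ x, mean ℝ (fun δ => κ x δ ^ p) ≤ 1) :
    (mean ℝ fun ε => mean ℝ fun δ => (mean ℝ fun x => w x * (κ x δ * φ (ε * x))) ^ p) ≤
      mean ℝ w ^ p * mean ℝ fun ε => φ ε ^ p := by
  have hφp : ∀ x, 0 ≤ φ x ^ p := fun x => Real.rpow_nonneg (hφ x) p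
  have hW := mean_nonneg hw
  have hWp : 0 ≤ mean ℝ w ^ (p - 1) := Real.rpow_nonneg hW _
  calc _ ≤ mean ℝ fun ε => mean ℝ fun δ =>
        mean ℝ w ^ (p - 1) * mean ℝ fun x => w x * (κ x δ ^ p * φ (ε * x) ^ p) := by
        refine mean_mono fun ε => mean_mono fun δ => ?_
        have h := rpow_mean_mul_le hp hw (v := fun x => κ x δ * φ (ε * x))
          fun x => mul_nonneg (hκ x δ) (hφ _)
        simpa only [Real.mul_rpow (hκ _ δ) (hφ _)] using h
    _ = mean ℝ fun ε => mean ℝ w ^ (p - 1) *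
        mean ℝ fun x => w x * (mean ℝ (fun δ => κ x δ ^ p) * φ (ε * x) ^ p) := by
        congr 1
        funext ε
        rw [mean_const_mul, mean_comm]
        simp only [mean_const_mul, mean_mul_const]
    _ ≤ mean ℝ fun ε => mean ℝ w ^ (p - 1) * mean ℝ fun x => w x * φ (ε * x) ^ p := by
        refine mean_mono fun ε => mul_le_mul_of_nonneg_left (mean_mono fun x => ?_) hWp
        exact mul_le_mul_of_nonneg_left (mul_le_of_le_one_left (hφp _) (hκ1 x)) (hw x)
    _ = mean ℝ w ^ (p - 1) * mean ℝ fun x => w x * mean ℝ fun ε => φ (ε * x) ^ p := by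
        rw [mean_const_mul, mean_comm]
        simp only [mean_const_mul]
    _ = mean ℝ w ^ (p - 1) * mean ℝ w * mean ℝ fun ε => φ ε ^ p := by
        have h : ∀ x, mean ℝ (fun ε => φ (ε * x) ^ p) = mean ℝ fun ε => φ ε ^ p := fun x => by
          simp only [mul_comm _ x]
          exact mean_mul_left ℝ x fun ε => φ ε ^ p
        simp only [h, mean_mul_const, mul_assoc]
    _ = _ := by
        congr 1
        have h := Real.rpow_add' hW (y := p - 1) (z := 1) (by linarith)
        rw [Real.rpow_one] at h
        rw [← h, sub_add_cancel]

/-- The upper Khintchine constant for the `L^p`-norm. -/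
def khintchineNorm (p : ℝ) : ℝ := khintchineConst p ^ (1 / p)

lemma khintchineNorm_pos (p : ℝ) : 0 < khintchineNorm p :=
  Real.rpow_pos_of_pos (zero_lt_one.trans_le (one_le_khintchineConst p)) _

lemma khintchineNorm_rpow {p : ℝ} (hp : 0 < p) : khintchineNorm p ^ p = khintchineConst p := by
  rw [khintchineNorm, ← Real.rpow_mul (zero_le_one.trans (one_le_khintchineConst p)),
    one_div_mul_cancel hp.ne', Real.rpow_one]

lemma mean_abs_rademacherSum_rpow_le' {p : ℝ} (hp : 0 < p) (a : Fin n → ℝ) :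
    mean ℝ (fun δ => |rademacherSum a δ| ^ p) ≤ (khintchineNorm p * √(∑ j, a j ^ 2)) ^ p := by
  rw [Real.mul_rpow (khintchineNorm_pos p).le (Real.sqrt_nonneg _), khintchineNorm_rpow hp]
  exact mean_abs_rademacherSum_rpow_le hp a

lemma mean_khintchineNorm_mul_sqrt_le (p : ℝ) :
    mean ℝ (fun x : Cube n => khintchineNorm p * √(∑ j, rieszKernel j x ^ 2)) ≤
      2 * khintchineNorm p * √n := by
  rw [mean_const_mul]
  have := mul_le_mul_of_nonneg_left (mean_sqrt_sum_rieszKernel_sq_le (n := n))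
    (khintchineNorm_pos p).le
  linarith

variable (𝕜 : Type u) [RCLike 𝕜] {X : Type v} [NormedAddCommGroup X] [NormedSpace 𝕜 X]

/-- The kernel of `∑_j δ_j Δ⁻¹ D_j`. -/
def randomKernel (x δ : Cube n) : ℝ := rademacherSum (fun j => rieszKernel j x) δ

lemma ofReal_randomKernel (x δ : Cube n) :
    ((randomKernel x δ : ℝ) : 𝕜) = ∑ j, sgn 𝕜 (δ j) * ((rieszKernel j x : ℝ) : 𝕜) := by
  simp [randomKernel, rademacherSum, ofReal_sgn]

lemma sum_sgn_smul_invLaplacian_D (g : Cube n → X) (ε δ : Cube n) :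
    ∑ j, sgn 𝕜 (δ j) • invLaplacian 𝕜 (D 𝕜 j g) ε =
      mean 𝕜 fun x => ((randomKernel x δ : ℝ) : 𝕜) • g (ε * x) := by
  simp only [invLaplacian_D, ← mean_smul, ← mean_sum, ofReal_randomKernel, Finset.sum_smul,
    mul_smul]

lemma sum_invLaplacian_D_rademacherCoeff (F : Cube n → Cube n → X) (ε : Cube n) :
    ∑ j, invLaplacian 𝕜 (D 𝕜 j (rademacherCoeff 𝕜 F j)) ε =
      mean 𝕜 fun x => mean 𝕜 fun δ => ((randomKernel x δ : ℝ) : 𝕜) • F (ε * x) δ := by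
  simp only [invLaplacian_D, rademacherCoeff, ← mean_smul, ← mean_sum, ofReal_randomKernel,
    Finset.sum_smul, mul_smul]
  congr 1
  funext x
  congr 1
  funext δ
  exact Finset.sum_congr rfl fun j _ => smul_comm _ _ _

lemma rpow_one_div_le_mul {p W A M : ℝ} (hp : 0 < p) (hW : 0 ≤ W) (hM : 0 ≤ M) (hA : 0 ≤ A)
    (h : A ≤ W ^ p * M) : A ^ (1 / p) ≤ W * M ^ (1 / p) := by
  calc _ ≤ (W ^ p * M) ^ (1 / p) := Real.rpow_le_rpow hA h (by positivity)
    _ = _ := by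
      rw [Real.mul_rpow (Real.rpow_nonneg hW p) hM, ← Real.rpow_mul hW, mul_one_div_cancel hp.ne',
        Real.rpow_one]

/-- The Riesz transform bound with constant `O(√n)` holds in every normed space. -/
theorem rieszTransformBound {p : ℝ} (hp : 1 < p) (n : ℕ) :
    RieszTransformBound 𝕜 X p n (2 * khintchineNorm p * √n) := by
  intro g
  have hp0 : 0 < p := by linarith
  set w : Cube n → ℝ := fun x => khintchineNorm p * √(∑ j, rieszKernel j x ^ 2) with hw
  have hw0 : ∀ x, 0 ≤ w x := fun x => mul_nonneg (khintchineNorm_pos p).le (Real.sqrt_nonneg _)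
  -- Where w vanishes, so do all k_j, and the convention a/0 = 0 keeps |k| = w κ true.
  set κ : Cube n → Cube n → ℝ := fun x δ => |randomKernel x δ| / w x with hκ
  have hκ0 : ∀ x δ, 0 ≤ κ x δ := fun x δ => div_nonneg (abs_nonneg _) (hw0 x)
  have hκ1 : ∀ x, mean ℝ (fun δ => κ x δ ^ p) ≤ 1 := by
    intro x
    simp only [hκ, Real.div_rpow (abs_nonneg _) (hw0 x)]
    simp only [div_eq_mul_inv, mean_mul_const]
    rw [← div_eq_mul_inv]
    exact (div_le_div_of_nonneg_right (mean_abs_rademacherSum_rpow_le' hp0 _)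
      (Real.rpow_nonneg (hw0 x) p)).trans (div_self_le_one _)
  have hwκ : ∀ x δ, |randomKernel x δ| = w x * κ x δ := by
    intro x δ
    by_cases h : w x = 0
    · have h1 : ∑ j, rieszKernel j x ^ 2 = 0 := by
        have h2 := (mul_eq_zero.1 h).resolve_left (khintchineNorm_pos p).ne'
        rwa [Real.sqrt_eq_zero (Finset.sum_nonneg fun j _ => sq_nonneg _)] at h2
      rw [h, zero_mul, randomKernel, rademacherSum_eq_zero h1, abs_zero]
    · simp only [hκ]
      field_simp
  have hn : ∀ ε δ : Cube n, ‖∑ j, sgn 𝕜 (δ j) • invLaplacian 𝕜 (D 𝕜 j g) ε‖ ≤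
      mean ℝ fun x => w x * (κ x δ * ‖g (ε * x)‖) := by
    intro ε δ
    rw [sum_sgn_smul_invLaplacian_D]
    refine (norm_mean_le 𝕜 _).trans (le_of_eq ?_)
    simp only [norm_smul, RCLike.norm_ofReal, hwκ, mul_assoc]
  have hM : 0 ≤ mean ℝ fun ε => ‖g ε‖ ^ p :=
    mean_nonneg fun ε => Real.rpow_nonneg (norm_nonneg _) p
  have h := mean_convolution_rpow_le hp.le hw0 (fun x => norm_nonneg (g x)) hκ0 hκ1
  refine (rpow_one_div_le_mul hp0 (mean_nonneg hw0) hM ?_ (le_trans ?_ h)).trans ?_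
  · exact mean_nonneg fun ε => mean_nonneg fun δ => Real.rpow_nonneg (norm_nonneg _) p
  · exact mean_mono fun ε => mean_mono fun δ =>
      Real.rpow_le_rpow (norm_nonneg _) (hn ε δ) hp0.le
  · exact mul_le_mul_of_nonneg_right (mean_khintchineNorm_mul_sqrt_le p) (Real.rpow_nonneg hM _)

/-- The dual bound with constant `O(√n)` holds in every normed space. -/
theorem rieszSumBound {p : ℝ} (hp : 1 < p) (n : ℕ) :
    RieszSumBound 𝕜 X p n (2 * khintchineNorm p.conjExponent * √n) := by
  intro F
  have hp0 : 0 < p := by linarith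
  have hpq : p.HolderConjugate p.conjExponent := Real.HolderConjugate.conjExponent hp
  set q := p.conjExponent
  have hq0 : 0 < q := hpq.symm.pos
  set w : Cube n → ℝ := fun x => khintchineNorm q * √(∑ j, rieszKernel j x ^ 2) with hw
  have hw0 : ∀ x, 0 ≤ w x := fun x => mul_nonneg (khintchineNorm_pos q).le (Real.sqrt_nonneg _)
  have hM : ∀ ε, 0 ≤ mean ℝ fun δ => ‖F ε δ‖ ^ p := fun ε =>
    mean_nonneg fun δ => Real.rpow_nonneg (norm_nonneg _) p
  set φ : Cube n → ℝ := fun ε => (mean ℝ fun δ => ‖F ε δ‖ ^ p) ^ (1 / p) with hφ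
  have hφ0 : ∀ ε, 0 ≤ φ ε := fun ε => Real.rpow_nonneg (hM ε) _
  have hφp : ∀ ε, φ ε ^ p = mean ℝ fun δ => ‖F ε δ‖ ^ p := fun ε => by
    rw [hφ, ← Real.rpow_mul (hM ε), one_div_mul_cancel hp0.ne', Real.rpow_one]
  have hn : ∀ ε : Cube n, ‖∑ j, invLaplacian 𝕜 (D 𝕜 j (rademacherCoeff 𝕜 F j)) ε‖ ≤
      mean ℝ fun x => w x * (1 * φ (ε * x)) := by
    intro ε
    rw [sum_invLaplacian_D_rademacherCoeff]
    refine (norm_mean_le 𝕜 _).trans (mean_mono fun x => (norm_mean_le 𝕜 _).trans ?_)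
    simp only [norm_smul, RCLike.norm_ofReal, one_mul]
    -- Hölder in δ puts the kernel in the conjugate exponent and leaves the L^p(δ)-norm φ of F; the
    -- convolution inequality then needs only κ = 1.
    refine (mean_mul_le hpq.symm (fun δ => abs_nonneg _) fun δ => norm_nonneg _).trans ?_
    refine mul_le_mul_of_nonneg_right ?_ (hφ0 _)
    have h := mean_abs_rademacherSum_rpow_le' hq0 fun j => rieszKernel j x
    refine (Real.rpow_le_rpow
      (mean_nonneg fun δ => Real.rpow_nonneg (abs_nonneg _) q) h (by positivity)).trans ?_
    rw [← Real.rpow_mul (hw0 x), mul_one_div_cancel hq0.ne', Real.rpow_one]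
  have h := mean_convolution_rpow_le hp.le hw0 hφ0 (κ := fun _ _ => 1)
    (fun _ _ => zero_le_one) (fun _ => by simp [mean_const])
  simp only [mean_const, hφp] at h
  refine (rpow_one_div_le_mul hp0 (mean_nonneg hw0) (mean_nonneg hM) ?_ (le_trans ?_ h)).trans ?_
  · exact mean_nonneg fun ε => Real.rpow_nonneg (norm_nonneg _) p
  · exact mean_mono fun ε => Real.rpow_le_rpow (norm_nonneg _) (hn ε) hp0.le
  · exact mul_le_mul_of_nonneg_right (mean_khintchineNorm_mul_sqrt_le q)
      (Real.rpow_nonneg (mean_nonneg hM) _)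

end UpperBound

/-! ### Cotype of ℓ¹. -/

section EllOne

variable (𝕜 : Type u) [RCLike 𝕜] {ι : Type}

/-- The space `ℓ¹(ι)`. -/
abbrev EllOne (ι : Type) : Type u := lp (fun _ : ι => 𝕜) 1

variable {𝕜}

lemma EllOne.hasSum_norm (x : EllOne 𝕜 ι) : HasSum (fun k => ‖x k‖) ‖x‖ := by
  simpa using lp.hasSum_norm (p := 1) (by simp) x

lemma sum_rpow_rpow_inv_le_sqrt {m : ℕ} {q : ℝ} (hq : 2 ≤ q) {a : Fin m → ℝ} (ha : ∀ i, 0 ≤ a i) :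
    (∑ i, a i ^ q) ^ (1 / q) ≤ √(∑ i, a i ^ 2) := by
  have hq0 : 0 < q := by linarith
  have hS : 0 ≤ ∑ i, a i ^ 2 := Finset.sum_nonneg fun i _ => sq_nonneg _
  have hle : ∀ i, a i ≤ √(∑ i, a i ^ 2) := fun i =>
    Real.le_sqrt_of_sq_le (Finset.single_le_sum (f := fun i => a i ^ 2)
      (fun i _ => sq_nonneg _) (Finset.mem_univ i))
  have hadd : ∀ t : ℝ, 0 ≤ t → t ^ q = t ^ 2 * t ^ (q - 2) := by
    intro t ht
    rw [← Real.rpow_two, ← Real.rpow_add' ht (by linarith)]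
    congr 1
    ring
  rw [one_div, Real.rpow_inv_le_iff_of_pos (Finset.sum_nonneg fun i _ => Real.rpow_nonneg (ha i) q)
    (Real.sqrt_nonneg _) hq0]
  calc _ ≤ ∑ i, a i ^ 2 * √(∑ i, a i ^ 2) ^ (q - 2) := by
        refine Finset.sum_le_sum fun i _ => ?_
        rw [hadd _ (ha i)]
        exact mul_le_mul_of_nonneg_left (Real.rpow_le_rpow (ha i) (hle i) (by linarith))
          (sq_nonneg _)
    _ = _ := by rw [← Finset.sum_mul, hadd _ (Real.sqrt_nonneg _), Real.sq_sqrt hS]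

/-- The lower Khintchine inequality in `L¹` for scalar coefficients. -/
lemma sqrt_sum_norm_sq_le {m : ℕ} (a : Fin m → 𝕜) :
    √(∑ i, ‖a i‖ ^ 2) ≤ 40 * mean ℝ fun δ : Cube m => ‖∑ i, sgn 𝕜 (δ i) • a i‖ := by
  have hre := sqrt_le_mean_abs_rademacherSum fun i => RCLike.re (a i)
  have him := sqrt_le_mean_abs_rademacherSum fun i => RCLike.im (a i)
  have h1 : mean ℝ (fun δ => |rademacherSum (fun i => RCLike.re (a i)) δ|) ≤
      mean ℝ fun δ : Cube m => ‖∑ i, sgn 𝕜 (δ i) • a i‖ := by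
    refine mean_mono fun δ => le_trans (le_of_eq ?_) (RCLike.abs_re_le_norm _)
    simp [rademacherSum, ← ofReal_sgn 𝕜]
  have h2 : mean ℝ (fun δ => |rademacherSum (fun i => RCLike.im (a i)) δ|) ≤
      mean ℝ fun δ : Cube m => ‖∑ i, sgn 𝕜 (δ i) • a i‖ := by
    refine mean_mono fun δ => le_trans (le_of_eq ?_) (RCLike.abs_im_le_norm _)
    simp [rademacherSum, ← ofReal_sgn 𝕜]
  have h3 : ∑ i, ‖a i‖ ^ 2 = ∑ i, RCLike.re (a i) ^ 2 + ∑ i, RCLike.im (a i) ^ 2 := by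
    rw [← Finset.sum_add_distrib]
    refine Finset.sum_congr rfl fun i _ => ?_
    rw [RCLike.norm_sq_eq_def]
    ring
  have h4 : √(∑ i, RCLike.re (a i) ^ 2 + ∑ i, RCLike.im (a i) ^ 2) ≤
      √(∑ i, RCLike.re (a i) ^ 2) + √(∑ i, RCLike.im (a i) ^ 2) := by
    have hr : 0 ≤ ∑ i, RCLike.re (a i) ^ 2 := Finset.sum_nonneg fun i _ => sq_nonneg _
    have hi : 0 ≤ ∑ i, RCLike.im (a i) ^ 2 := Finset.sum_nonneg fun i _ => sq_nonneg _
    rw [Real.sqrt_le_left (by positivity), add_sq, Real.sq_sqrt hr, Real.sq_sqrt hi]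
    have : 0 ≤ 2 * √(∑ i, RCLike.re (a i) ^ 2) * √(∑ i, RCLike.im (a i) ^ 2) := by positivity
    linarith
  rw [h3]
  linarith

/-- `ℓ¹` has cotype `q` for every `q ≥ 2`. -/
lemma EllOne.hasCotype {q : ℝ} (hq : 2 ≤ q) : HasCotype 𝕜 (EllOne 𝕜 ι) q := by
  refine ⟨40, fun m x => ?_⟩
  set S := ∑ i, ‖x i‖ ^ 2 with hS
  have hS0 : 0 ≤ S := Finset.sum_nonneg fun i _ => sq_nonneg _
  set M := mean ℝ fun δ : Cube m => ‖∑ i, sgn 𝕜 (δ i) • x i‖ with hM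
  have hM0 : 0 ≤ M := mean_nonneg fun δ => norm_nonneg _
  have hM' : M ≤ pNorm q fun δ : Cube m => ∑ i, sgn 𝕜 (δ i) • x i :=
    mean_norm_le_pNorm (by linarith) _
  have hl : HasSum (fun k => ∑ i, ‖x i‖ * ‖x i k‖) S := by
    have := hasSum_sum (s := Finset.univ) fun i (_ : i ∈ Finset.univ) =>
      (EllOne.hasSum_norm (x i)).mul_left ‖x i‖
    simpa only [hS, sq] using this
  have hr : HasSum (fun k => √S * (40 * mean ℝ fun δ : Cube m => ‖∑ i, sgn 𝕜 (δ i) • x i k‖))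
      (√S * (40 * M)) := by
    refine ((HasSum.mul_left _ (hasSum_sum fun δ _ => ?_)).mul_left _).mul_left _
    have := EllOne.hasSum_norm (∑ i, sgn 𝕜 (δ i) • x i)
    simpa only [lp.coeFn_sum, Finset.sum_apply, lp.coeFn_smul, Pi.smul_apply] using this
  -- Coordinatewise Cauchy–Schwarz against the vector of norms ‖x_i‖, followed by scalar Khintchine;
  -- summing over coordinates recovers the ℓ¹-norms.
  have hle : S ≤ √S * (40 * M) := by
    refine hasSum_le (fun k => ?_) hl hr
    refine (Real.sum_mul_le_sqrt_mul_sqrt _ _ _).trans ?_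
    exact mul_le_mul_of_nonneg_left (sqrt_sum_norm_sq_le fun i => x i k) (Real.sqrt_nonneg _)
  refine (sum_rpow_rpow_inv_le_sqrt hq fun i => norm_nonneg (x i)).trans ?_
  have : √S ≤ 40 * M := by
    rcases (Real.sqrt_nonneg S).eq_or_lt with h | h
    · rw [← h]; positivity
    · nlinarith [Real.mul_self_sqrt hS0]
  linarith

end EllOne

/-! ### Sharpness of √n: the majority function and ℓ¹ over cubes. -/

section LowerBound

variable {n : ℕ}

/-- The majority function. -/
def majority (x : Cube n) : ℝ := if 0 ≤ ∑ j, sgn ℝ (x j) then 1 else -1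

lemma abs_majority (x : Cube n) : |majority x| = 1 := by
  unfold majority
  split_ifs <;> simp

lemma majority_mul_sum (x : Cube n) :
    majority x * ∑ j, sgn ℝ (x j) = |∑ j, sgn ℝ (x j)| := by
  unfold majority
  split_ifs with h
  · rw [one_mul, abs_of_nonneg h]
  · rw [neg_one_mul, abs_of_neg (not_le.1 h)]

lemma mean_walsh (A : Finset (Fin n)) : mean ℝ (walsh ℝ A) = if A = ∅ then 1 else 0 := by
  have h := mean_prod fun (i : Fin n) s => if i ∈ A then sgn ℝ s else 1
  simp only [Finset.prod_ite_mem, Finset.univ_inter] at h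
  have h' : mean ℝ (walsh ℝ A) = _ := h
  rw [h']
  split_ifs with hA
  · simp [hA]
  · obtain ⟨i, hi⟩ := Finset.nonempty_iff_ne_empty.2 hA
    exact Finset.prod_eq_zero (Finset.mem_univ i) (by simp [hi])

/-- This mean is the Walsh coefficient of the kernel at {j}, where 1/|A| = 1. -/
lemma mean_rieszKernel_mul_sgn (j : Fin n) :
    mean ℝ (fun x => rieszKernel j x * sgn ℝ (x j)) = 1 := by
  have h : ∀ x : Cube n, rieszKernel j x * sgn ℝ (x j) = ∑ A : Finset (Fin n),
      if j ∈ A then (A.card : ℝ)⁻¹ * walsh ℝ (A.erase j) x else 0 := by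
    intro x
    rw [rieszKernel, Finset.sum_mul]
    refine Finset.sum_congr rfl fun A _ => ?_
    split_ifs with hA
    · rw [walsh, ← Finset.mul_prod_erase A _ hA, walsh]
      linear_combination ((A.card : ℝ)⁻¹ * ∏ i ∈ A.erase j, sgn ℝ (x i)) * sgn_sq ℝ (x j)
    · rw [zero_mul]
  simp only [h, mean_sum]
  rw [Finset.sum_eq_single {j}]
  · simp only [Finset.mem_singleton, if_true, mean_const_mul, mean_walsh]
    simp
  · intro A _ hA
    split_ifs with hj
    · rw [mean_const_mul, mean_walsh, if_neg, mul_zero]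
      intro h0
      exact hA (by rw [← Finset.insert_erase hj, h0]; rfl)
    · exact mean_const ℝ 0
  · simp

/-- The kernel of `∑_j δ_j Δ⁻¹ D_j` tested against the majority function. -/
lemma sqrt_le_mean_mean_randomKernel_mul_majority (n : ℕ) :
    (1 / 20) * √n ≤
      mean ℝ fun δ : Cube n => mean ℝ fun x => randomKernel x δ * majority (x * δ) := by
  have h1 : (mean ℝ fun δ : Cube n => mean ℝ fun x => randomKernel x δ * majority (x * δ)) =
      mean ℝ fun δ : Cube n => |rademacherSum (fun _ => 1) δ| := by
    calc _ = mean ℝ fun x : Cube n => mean ℝ fun δ => randomKernel x δ * majority (x * δ) :=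
          mean_comm ℝ _
      -- Substituting xδ for δ frees majority of x, so the x-average falls on the kernel alone.
      _ = mean ℝ fun x : Cube n => mean ℝ fun δ => randomKernel x (x * δ) * majority δ := by
          congr 1
          funext x
          rw [← mean_mul_left ℝ x]
          simp only [← mul_assoc, cube_mul_self, one_mul]
      _ = mean ℝ fun δ : Cube n => mean ℝ fun x => randomKernel x (x * δ) * majority δ :=
          mean_comm ℝ _
      _ = _ := by
          congr 1
          funext δ
          have h : ∀ x : Cube n, randomKernel x (x * δ) =
              ∑ j, sgn ℝ (δ j) * (rieszKernel j x * sgn ℝ (x j)) := fun x => by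
            rw [randomKernel, rademacherSum]
            refine Finset.sum_congr rfl fun j _ => ?_
            rw [Pi.mul_apply, sgn_mul]
            ring
          simp only [mean_mul_const, h, mean_sum, mean_const_mul, mean_rieszKernel_mul_sgn,
            mul_one, rademacherSum]
          rw [mul_comm, majority_mul_sum]
  rw [h1]
  simpa using sqrt_le_mean_abs_rademacherSum fun _ : Fin n => 1

variable (𝕜 : Type u) [RCLike 𝕜]

/-- The space `ℓ¹` over the disjoint union of all cubes. -/
abbrev CubeEllOne : Type u := EllOne 𝕜 (Σ n, Cube n)

/-- The unit vector of `CubeEllOne` at a point of a cube. -/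
def cubeUnit (x : Cube n) : CubeEllOne 𝕜 := lp.single 1 ⟨n, x⟩ 1

lemma norm_cubeUnit (x : Cube n) : ‖cubeUnit 𝕜 x‖ = 1 := by
  rw [cubeUnit, lp.norm_single zero_lt_one, norm_one]

/-- The functional on `CubeEllOne` given by a translate of the majority function. -/
def majorityFunctional (ε : Cube n) : StrongDual 𝕜 (CubeEllOne 𝕜) :=
  ∑ u : Cube n, ((majority (ε * u) : ℝ) : 𝕜) •
    lp.evalCLM 𝕜 (fun _ : Σ n, Cube n => 𝕜) 1 (⟨n, u⟩ : Σ n, Cube n)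

lemma majorityFunctional_apply (ε : Cube n) (z : CubeEllOne 𝕜) :
    majorityFunctional 𝕜 ε z = ∑ u : Cube n, ((majority (ε * u) : ℝ) : 𝕜) * z ⟨n, u⟩ := by
  simp only [majorityFunctional, sum_apply, smul_apply,
    smul_eq_mul]
  rfl

lemma majorityFunctional_cubeUnit (ε x : Cube n) :
    majorityFunctional 𝕜 ε (cubeUnit 𝕜 x) = ((majority (ε * x) : ℝ) : 𝕜) := by
  rw [majorityFunctional_apply, Finset.sum_eq_single x]
  · rw [cubeUnit, lp.single_apply_self, mul_one]
  · intro u _ hu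
    rw [cubeUnit, lp.single_apply_ne, mul_zero]
    simpa using hu
  · simp

lemma norm_majorityFunctional (ε : Cube n) : ‖majorityFunctional 𝕜 ε‖ = 1 := by
  refine le_antisymm (ContinuousLinearMap.opNorm_le_bound _ zero_le_one fun z => ?_) ?_
  · rw [majorityFunctional_apply, one_mul]
    refine (norm_sum_le _ _).trans ?_
    simp only [norm_mul, RCLike.norm_ofReal, abs_majority, one_mul]
    have h := sum_le_hasSum (Finset.univ.map (Function.Embedding.sigmaMk n))
      (fun k _ => norm_nonneg (z k)) (EllOne.hasSum_norm z)
    rwa [Finset.sum_map] at h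
  · have h := (majorityFunctional 𝕜 ε).le_opNorm (cubeUnit 𝕜 (1 : Cube n))
    rwa [majorityFunctional_cubeUnit, RCLike.norm_ofReal, abs_majority, norm_cubeUnit,
      mul_one] at h

theorem sqrt_le_of_rieszTransformBound {p : ℝ} (hp : 1 < p) {n : ℕ} {K : ℝ}
    (h : RieszTransformBound 𝕜 (StrongDual 𝕜 (CubeEllOne 𝕜)) p n K) : (1 / 20) * √n ≤ K := by
  have hK := h fun ε => majorityFunctional 𝕜 ε
  have hg : pNorm p (fun ε : Cube n => majorityFunctional 𝕜 ε) = 1 := by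
    simp [pNorm, norm_majorityFunctional, mean_const]
  rw [hg, mul_one] at hK
  refine le_trans ?_ ((mean_norm_le_pNorm₂ hp.le _).trans hK)
  refine (sqrt_le_mean_mean_randomKernel_mul_majority n).trans ?_
  -- A dummy average over ε is inserted: the estimate holds for each ε, by translation invariance of
  -- the construction.
  rw [← mean_const (n := n) ℝ (mean ℝ _)]
  refine mean_mono fun ε => mean_mono fun δ => ?_
  rw [sum_sgn_smul_invLaplacian_D]
  set L := mean 𝕜 fun x => ((randomKernel x δ : ℝ) : 𝕜) • majorityFunctional 𝕜 (ε * x) with hL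
  -- The unit vector at εδ cancels the translation by ε, leaving majority at xδ.
  have h1 : L (cubeUnit 𝕜 (ε * δ)) =
      ((mean ℝ fun x => randomKernel x δ * majority (x * δ) : ℝ) : 𝕜) := by
    rw [← mean_ofReal]
    refine (mean_apply_clm 𝕜 (ContinuousLinearMap.apply 𝕜 𝕜 (cubeUnit 𝕜 (ε * δ))) _).trans ?_
    congr 1
    funext x
    rw [ContinuousLinearMap.apply_apply, smul_apply,
      majorityFunctional_cubeUnit, mul_mul_mul_comm, cube_mul_self, one_mul, RCLike.ofReal_mul,
      smul_eq_mul]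
  have h2 := L.le_opNorm (cubeUnit 𝕜 (ε * δ))
  rw [h1, RCLike.norm_ofReal, norm_cubeUnit, mul_one] at h2
  exact (le_abs_self _).trans h2

theorem sqrt_le_of_rieszSumBound {p : ℝ} (hp : 1 < p) {n : ℕ} {K : ℝ}
    (h : RieszSumBound 𝕜 (CubeEllOne 𝕜) p n K) : (1 / 20) * √n ≤ K := by
  have hK := h fun ε δ => cubeUnit 𝕜 (ε * δ)
  have hF : pNorm₂ p (fun ε δ : Cube n => cubeUnit 𝕜 (ε * δ)) = 1 := by
    simp [pNorm₂, norm_cubeUnit, mean_const]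
  rw [hF, mul_one] at hK
  refine le_trans ?_ ((mean_norm_le_pNorm hp.le _).trans hK)
  refine (sqrt_le_mean_mean_randomKernel_mul_majority n).trans ?_
  rw [← mean_const (n := n) ℝ (mean ℝ _)]
  refine mean_mono fun ε => ?_
  rw [sum_invLaplacian_D_rademacherCoeff]
  set z := mean 𝕜 fun x => mean 𝕜 fun δ =>
    ((randomKernel x δ : ℝ) : 𝕜) • cubeUnit 𝕜 (ε * x * δ) with hz
  -- The norm-one functional translated by ε cancels the ε in the unit vectors, giving the same
  -- scalar average as in the dual estimate.
  have h1 : majorityFunctional 𝕜 ε z =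
      ((mean ℝ fun δ : Cube n => mean ℝ fun x => randomKernel x δ * majority (x * δ) : ℝ) : 𝕜) := by
    rw [mean_comm ℝ fun (δ x : Cube n) => randomKernel x δ * majority (x * δ)]
    simp only [← mean_ofReal, hz, mean_apply_clm, map_smul, majorityFunctional_cubeUnit,
      ← mul_assoc, cube_mul_self, one_mul, RCLike.ofReal_mul, smul_eq_mul]
  have h2 := (majorityFunctional 𝕜 ε).le_opNorm z
  rw [h1, RCLike.norm_ofReal, norm_majorityFunctional, one_mul] at h2
  exact (le_abs_self _).trans h2

end LowerBound

end HammingCube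

end

theorem theorem3p1 (𝕜 : Type u) [RCLike 𝕜] (p q : ℝ) (hp : 1 < p) (hq : 2 ≤ q) :
    (∃ C : ℝ, 0 < C ∧
      ∀ (X : Type v) [NormedAddCommGroup X] [NormedSpace 𝕜 X] [CompleteSpace X],
        HammingCube.HasCotype 𝕜 X q →
        ∀ n : ℕ,
          HammingCube.RieszSumBound 𝕜 X p n (C * Real.sqrt n) ∧
          HammingCube.RieszTransformBound 𝕜 (StrongDual 𝕜 X) p n (C * Real.sqrt n)) ∧
    (∃ (X : Type u) (_ : NormedAddCommGroup X) (_ : NormedSpace 𝕜 X) (_ : CompleteSpace X),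
        HammingCube.HasCotype 𝕜 X q ∧
        ∃ c : ℝ, 0 < c ∧
          ∀ (n : ℕ) (K : ℝ),
            (HammingCube.RieszSumBound 𝕜 X p n K → c * Real.sqrt n ≤ K) ∧
            (HammingCube.RieszTransformBound 𝕜 (StrongDual 𝕜 X) p n K → c * Real.sqrt n ≤ K)) := by
  have h1 := HammingCube.khintchineNorm_pos p
  have h2 := HammingCube.khintchineNorm_pos p.conjExponent
  refine ⟨⟨2 * HammingCube.khintchineNorm p + 2 * HammingCube.khintchineNorm p.conjExponent,
    by positivity, fun X _ _ _ _ n => ⟨fun F => ?_, fun g => ?_⟩⟩,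
    HammingCube.CubeEllOne 𝕜, inferInstance, inferInstance, inferInstance,
    HammingCube.EllOne.hasCotype hq, 1 / 20, by norm_num, fun n K =>
      ⟨HammingCube.sqrt_le_of_rieszSumBound 𝕜 hp, HammingCube.sqrt_le_of_rieszTransformBound 𝕜 hp⟩⟩
  · refine (HammingCube.rieszSumBound 𝕜 hp n F).trans ?_
    refine mul_le_mul_of_nonneg_right (mul_le_mul_of_nonneg_right ?_ (Real.sqrt_nonneg _)) ?_
    · linarith
    · exact Real.rpow_nonneg (HammingCube.mean_nonneg fun ε => HammingCube.mean_nonneg fun δ =>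
        Real.rpow_nonneg (norm_nonneg _) p) _
  · refine (HammingCube.rieszTransformBound 𝕜 hp n g).trans ?_
    refine mul_le_mul_of_nonneg_right (mul_le_mul_of_nonneg_right ?_ (Real.sqrt_nonneg _)) ?_
    · linarith
    · exact Real.rpow_nonneg (HammingCube.mean_nonneg fun ε =>
        Real.rpow_nonneg (norm_nonneg _) p) _
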